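/- Let $1<\gamma<2$ and let $\mathscr D$ be a random variable with values in $\{0,1,2,\dots\}$ such that $\mathbb P(\mathscr D>t)=\mathcal L(t)\,t^{-\gamma}$ for all $t>0$, where $\mathcal L$ is slowly varying at infinity. For each $n$, let $D_1,\dots,D_n$ be the first $n$ terms of a sequence of i.i.d. copies of $\mathscr D$, where the last degree $D_n$ is increased by one if the sum would otherwise be odd. Given $(D_1,\dots,D_n)$, let $G_n$ be the configuration model on these degrees: vertex $i$ receives $D_i$ stubs, and all stubs are paired by a uniformly random perfect matching. Let $X_{ij}$ be the number of edges of $G_n$ between $i$ and $j$ (with $X_{ii}$ twice the number of self-loops at $i$). The erased configuration model $\widehat G_n$ is the simple graph obtained from $G_n$ by removing all self-loops and replacing multiple edges by single edges; $\widehat D_i$ denotes the degree of $i$ in $\widehat G_n$. Let $Z_{ij}=X_{ij}-\mathbf 1\{X_{ij}>0\}$ for $i\neq j$ and $Z_{ii}=X_{ii}$ be the number of removed edges between $i$ and $j$ (self-loops counted twice), and let $Y_i=\sum_{j=1}^n Z_{ij}$ be the number of removed stubs at $i$. Then, as $n\to\infty$: 1. for every integer $p\ge 0$ and every $\delta>0$,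 $$\frac{\sum_{i=1}^n D_i^p\,Y_i}{n^{p/\gamma+2-\gamma+\delta}}\to 0\quad\text{in probability};$$ 2. for every $\delta>0$, $$\frac{\sum_{1\le i<j\le n} Z_{ij}D_iD_j}{n^{2/\gamma+2-\gamma+\delta}}\to 0\quad\text{in probability};$$ 3. for every integer $q\ge 1$ and every $\delta>0$, $$\frac{\left|\sum_{i=1}^n D_i^q-\sum_{i=1}^n \widehat D_i^{\,q}\right|}{n^{(q-1)/\gamma+2-\gamma+\delta}}\to 0\quad\text{in probability}.$$ -/

import Mathlib

open MeasureTheory ProbabilityTheory Filter Topology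

/-- `L` is slowly varying at infinity: it is positive and measurable on some half-line `[a, ∞)`, and
`L (c t) / L t → 1` as `t → ∞` for every `c > 0`. -/
def IsSlowlyVarying (L : ℝ → ℝ) : Prop :=
  (∃ a : ℝ, (∀ t, a ≤ t → 0 < L t) ∧ Measurable (fun t : Set.Ici a => L t)) ∧
    ∀ c : ℝ, 0 < c → Tendsto (fun t => L (c * t) / L t) atTop (𝓝 1)

/-- The law `ν` of a nonnegative integer-valued random variable is regularly varying with exponent
`γ`: `ν (t, ∞) = L(t) t^(-γ)` for `t > 0`, with `L` slowly varying at infinity. -/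
def HasRegularlyVaryingTail (ν : Measure ℕ) (γ : ℝ) : Prop :=
  ∃ L : ℝ → ℝ, IsSlowlyVarying L ∧
    ∀ t : ℝ, 0 < t → ν.real {k : ℕ | t < (k : ℝ)} = L t * t ^ (-γ)

/-- The stubs of a degree sequence: vertex `i` carries `d i` stubs. -/
abbrev Stub {n : ℕ} (d : Fin n → ℕ) : Type := Σ i : Fin n, Fin (d i)

/-- A pairing of the stubs into edges: a fixed-point-free involution, which sends each stub to its
partner. -/
abbrev StubPairing {n : ℕ} (d : Fin n → ℕ) : Type :=
  {σ : Equiv.Perm (Stub d) // ∀ s, σ s ≠ s ∧ σ (σ s) = s}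

/-- The edge multiplicities of the multigraph of a pairing: the number of stubs at `i` whose partner
is a stub at `j`. For `i ≠ j` this is the number of edges between `i` and `j`; for `i = j` it is
twice the number of self-loops at `i`. -/
def StubPairing.edgeCount {n : ℕ} {d : Fin n → ℕ} (σ : StubPairing d) (i j : Fin n) : ℕ :=
  (Finset.univ.filter fun a : Fin (d i) => (σ.1 ⟨i, a⟩).1 = j).card

/-- The probability that the configuration model on the degree sequence `d` (a uniformly random
pairing of the stubs) has edge multiplicities `x`. -/
noncomputable def cmProb {n : ℕ} (d : Fin n → ℕ) (x : Fin n → Fin n → ℕ) : ℝ :=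
  ((Finset.univ.filter fun σ : StubPairing d => σ.edgeCount = x).card : ℝ) /
    (Fintype.card (StubPairing d) : ℝ)

/-- The degree sequence with the parity correction: if the sum is odd, the degree of the last vertex
is increased by one. -/
def evenDegrees {n : ℕ} (d : Fin n → ℕ) (i : Fin n) : ℕ :=
  if (i : ℕ) + 1 = n ∧ Odd (∑ j, d j) then d i + 1 else d i

/-- `X` holds the edge multiplicities of a configuration model with random degree sequence `D`:
conditionally on `D = d`, it is distributed as the configuration model on `d`. -/
structure IsConfigurationModel {Ω : Type*} [MeasurableSpace Ω] (P : Measure Ω) {n : ℕ}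
    (D : Ω → Fin n → ℕ) (X : Ω → Fin n → Fin n → ℕ) : Prop where
  measurable : Measurable X
  law : ∀ (d : Fin n → ℕ) (x : Fin n → Fin n → ℕ),
    P.real {ω | D ω = d ∧ X ω = x} = P.real {ω | D ω = d} * cmProb d x

/-- The erased simple graph of a multigraph with edge multiplicities `x`: self-loops are removed and
multiple edges are replaced by one edge. -/
def erasedGraph {n : ℕ} (x : Fin n → Fin n → ℕ) : SimpleGraph (Fin n) :=
  SimpleGraph.fromRel fun i j => 0 < x i j

open Classical in
/-- The degree of vertex `i` in the erased graph. -/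
noncomputable def erasedDegree {n : ℕ} (x : Fin n → Fin n → ℕ) (i : Fin n) : ℕ :=
  (erasedGraph x).degree i

open Classical in
/-- The number of removed edges between `i` and `j` (self-loops counted twice): the multiplicity in
the multigraph minus the multiplicity in the erased graph. -/
noncomputable def removedEdges {n : ℕ} (x : Fin n → Fin n → ℕ) (i j : Fin n) : ℕ :=
  x i j - if (erasedGraph x).Adj i j then 1 else 0

/-- The number of removed stubs at vertex `i`. -/
noncomputable def removedStubs {n : ℕ} (x : Fin n → Fin n → ℕ) (i : Fin n) : ℕ :=
  ∑ j, removedEdges x i j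

/-! Condition on degrees `d` with sum `L`, and put `x = d i * d j / L`. Since a stub's partner is
uniform, the multiplicity `X i j` (`i ≠ j`) has mean of order `x` and second factorial moment of
order at most `x ^ 2`. A removed edge count is at most `X` and at most `X * (X - 1)`, so its mean is
`O(min x (x ^ 2))`, hence `O(x ^ a)` for every `a ∈ [1, 2]` (`sum_removedEdges_le`).

Take `1 < a < γ`. The `a`-th moment is finite, so by the law of large numbers `∑ d ^ a ≤ C n` and `L
≥ c n` with high probability. As `ℓ^r` norms decrease in `r`, `∑ d ^ (p + a) ≤ (C n) ^ ((p + a) /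
a)`. The conditional mean of `∑ d ^ p * Y` off the diagonal is therefore of order at most `L ^ (-a)
* ∑ d ^ (p + a) * ∑ d ^ a = O(n ^ (p / a + 2 - a))`, and self-loops contribute no more. The weighted
sum over pairs is treated alike, and `|d ^ q - e ^ q| ≤ q * d ^ (q - 1) * (d - e)` reduces the third
claim to the first with `p = q - 1`.

The exponent is continuous in `a`, so `a` close to `γ` costs less than `δ`, and Markov's inequality
finishes (`tendstoInMeasure_div_rpow`). -/

/-- The pairings of a finite set: its fixed-point-free involutions. -/
abbrev Pairing (α : Type*) : Type _ := {σ : Equiv.Perm α // ∀ s, σ s ≠ s ∧ σ (σ s) = s}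

/-! ### Symmetry of uniform pairings. -/

namespace Pairing

variable {α : Type*}

/-- Relabelling a pairing by a permutation of the underlying set. -/
def relabel (τ : Equiv.Perm α) : Pairing α ≃ Pairing α where
  toFun σ := ⟨τ * σ.1 * τ⁻¹, fun s => by
    refine ⟨fun h => (σ.2 (τ⁻¹ s)).1 ?_, ?_⟩
    · rw [Equiv.Perm.mul_apply, Equiv.Perm.mul_apply] at h
      rw [← Equiv.Perm.eq_inv_iff_eq] at h
      exact h
    · simp [(σ.2 _).2]⟩
  invFun σ := ⟨τ⁻¹ * σ.1 * τ, fun s => by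
    refine ⟨fun h => (σ.2 (τ s)).1 ?_, ?_⟩
    · rw [Equiv.Perm.mul_apply, Equiv.Perm.mul_apply, Equiv.Perm.inv_eq_iff_eq] at h
      exact h.symm ▸ rfl
    · simp [(σ.2 _).2]⟩
  left_inv σ := by ext; simp
  right_inv σ := by ext; simp

lemma relabel_apply (τ : Equiv.Perm α) (σ : Pairing α) (s : α) :
    (relabel τ σ).1 s = τ (σ.1 (τ⁻¹ s)) := rfl

variable [Fintype α] [DecidableEq α]

/-- If a class of pairings is invariant under transpositions of `R`, and `u ∉ R` always has its
partner in `R`, then this partner is uniformly distributed on `R`. -/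
lemma card_mul_card_filter_eq (C : Pairing α → Prop) [DecidablePred C] (R : Finset α) (u : α)
    (hu : u ∉ R) (hR : ∀ σ, C σ → σ.1 u ∈ R)
    (hC : ∀ v ∈ R, ∀ w ∈ R, ∀ σ, C (relabel (Equiv.swap v w) σ) ↔ C σ) {v : α} (hv : v ∈ R) :
    R.card * (Finset.univ.filter fun σ : Pairing α => C σ ∧ σ.1 u = v).card =
      (Finset.univ.filter fun σ : Pairing α => C σ).card := by
  rw [Finset.card_eq_sum_card_fiberwise (s := Finset.univ.filter fun σ : Pairing α => C σ)
    (f := fun σ : Pairing α => σ.1 u) (t := R) (fun σ hσ => hR σ (by simpa using hσ)),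
    Finset.card_eq_sum_ones R, Finset.sum_mul]
  refine Finset.sum_congr rfl fun w hw => ?_
  rw [one_mul, Finset.filter_filter]
  -- Conjugation by the swap fixes `u` and exchanges the pairings with partner `v` and those with
  -- partner `w`, so all fibres over `R` have the same size.
  refine Finset.card_equiv (relabel (Equiv.swap v w)) fun σ => ?_
  have huv : u ≠ v := fun h => hu (h ▸ hv)
  have huw : u ≠ w := fun h => hu (h ▸ hw)
  simp only [Finset.mem_filter, Finset.mem_univ, true_and, hC v hv w hw, relabel_apply,
    Equiv.swap_inv, Equiv.swap_apply_of_ne_of_ne huv huw]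
  rw [Equiv.swap_apply_eq_iff, Equiv.swap_apply_right]

lemma card_filter_apply_eq {s t : α} (hst : s ≠ t) :
    (Fintype.card α - 1) * (Finset.univ.filter fun σ : Pairing α => σ.1 s = t).card =
      Fintype.card (Pairing α) := by
  have h := card_mul_card_filter_eq (fun _ : Pairing α => True) (Finset.univ.erase s) s (by simp)
    (fun σ _ => by simpa using (σ.2 s).1) (fun _ _ _ _ _ => Iff.rfl)
    (v := t) (by simpa using hst.symm)
  simpa [Finset.card_erase_of_mem] using h

/-- Once `s` and `t` are paired, swaps of points outside `{s, t, u}` preserve this condition, so the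
partner of `u` is uniform on the remaining points. -/
lemma card_filter_apply_eq_and {s t u v : α} (hst : s ≠ t) (hus : u ≠ s) (hut : u ≠ t)
    (hvs : v ≠ s) (hvt : v ≠ t) (hvu : v ≠ u) :
    (Fintype.card α - 3) *
        (Finset.univ.filter fun σ : Pairing α => σ.1 s = t ∧ σ.1 u = v).card =
      (Finset.univ.filter fun σ : Pairing α => σ.1 s = t).card := by
  have hcard : (({s, t, u} : Finset α)ᶜ).card = Fintype.card α - 3 := by
    rw [Finset.card_compl, Finset.card_eq_three.2 ⟨s, t, u, hst, hus.symm, hut.symm, rfl⟩]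
  rw [← hcard]
  refine card_mul_card_filter_eq (fun σ : Pairing α => σ.1 s = t) _ u (by simp) ?_ ?_
    (by simp [*])
  · intro σ hσ
    simp only [Finset.mem_compl, Finset.mem_insert, Finset.mem_singleton, not_or]
    refine ⟨fun h => hut ?_, fun h => hus ?_, (σ.2 u).1⟩
    · rw [← (σ.2 u).2, h, hσ]
    · exact σ.1.injective (h.trans hσ.symm)
  · intro v hv w hw σ
    simp only [Finset.mem_compl, Finset.mem_insert, Finset.mem_singleton, not_or] at hv hw
    rw [relabel_apply, Equiv.swap_inv,
      Equiv.swap_apply_of_ne_of_ne (Ne.symm hv.1) (Ne.symm hw.1), Equiv.swap_apply_eq_iff,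
      Equiv.swap_apply_of_ne_of_ne (Ne.symm hv.2.1) (Ne.symm hw.2.1)]

end Pairing

/-! ### First two factorial moments of the edge multiplicities. -/

namespace StubPairing

variable {n : ℕ} {d : Fin n → ℕ}

lemma card_stub (d : Fin n → ℕ) : Fintype.card (Stub d) = ∑ i, d i := by simp

lemma edgeCount_eq_sum (σ : StubPairing d) (i j : Fin n) :
    σ.edgeCount i j = ∑ a : Fin (d i), ∑ b : Fin (d j), if σ.1 ⟨i, a⟩ = ⟨j, b⟩ then 1 else 0 := by
  rw [edgeCount, Finset.card_filter]
  refine Finset.sum_congr rfl fun a _ => ?_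
  rcases h : σ.1 ⟨i, a⟩ with ⟨k, c⟩
  by_cases hk : k = j
  · subst hk
    simp
  · have : ∀ b : Fin (d j), (⟨k, c⟩ : Stub d) ≠ ⟨j, b⟩ := fun b hb => hk (congrArg Sigma.fst hb)
    simp [hk, this]

lemma edgeCount_comm (σ : StubPairing d) (i j : Fin n) : σ.edgeCount i j = σ.edgeCount j i := by
  rw [edgeCount_eq_sum, edgeCount_eq_sum, Finset.sum_comm]
  refine Finset.sum_congr rfl fun b _ => Finset.sum_congr rfl fun a _ => ?_
  have : σ.1 ⟨i, a⟩ = ⟨j, b⟩ ↔ σ.1 ⟨j, b⟩ = ⟨i, a⟩ :=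
    ⟨fun h => by rw [← h, (σ.2 _).2], fun h => by rw [← h, (σ.2 _).2]⟩
  simp only [this]

lemma sum_edgeCount (σ : StubPairing d) (i : Fin n) : ∑ j, σ.edgeCount i j = d i := by
  have h := Finset.card_eq_sum_card_fiberwise (s := (Finset.univ : Finset (Fin (d i))))
    (t := Finset.univ) (f := fun a => (σ.1 ⟨i, a⟩).1) (fun _ _ => by simp)
  rw [Finset.card_univ, Fintype.card_fin] at h
  exact h.symm

/-- The total number of stubs at `i` paired with stubs at `j`, over all pairings. -/
lemma sum_edgeCount_mul_le (d : Fin n → ℕ) (i j : Fin n) :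
    (∑ k, d k - 1) * ∑ σ : StubPairing d, σ.edgeCount i j ≤
      d i * d j * Fintype.card (StubPairing d) := by
  have key : ∀ (a : Fin (d i)) (b : Fin (d j)),
      (∑ k, d k - 1) * ∑ σ : StubPairing d, (if σ.1 ⟨i, a⟩ = ⟨j, b⟩ then 1 else 0) ≤
        Fintype.card (StubPairing d) := by
    intro a b
    rw [← Finset.card_filter]
    by_cases h : (⟨i, a⟩ : Stub d) = ⟨j, b⟩
    · rw [Finset.filter_false_of_mem]
      · simp
      · intro σ _ hσ
        exact (σ.2 _).1 (hσ.trans h.symm)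
    · rw [← card_stub]
      exact (Pairing.card_filter_apply_eq h).le
  simp only [edgeCount_eq_sum]
  rw [Finset.sum_comm, Finset.mul_sum]
  calc _ ≤ ∑ a : Fin (d i), ∑ b : Fin (d j), Fintype.card (StubPairing d) := by
        refine Finset.sum_le_sum fun a _ => ?_
        rw [Finset.sum_comm, Finset.mul_sum]
        exact Finset.sum_le_sum fun b _ => key a b
    _ = _ := by simp [mul_assoc]

/-- `X * X - X` counts ordered pairs of distinct stubs at `i` that are both matched into `j`. -/
lemma edgeCount_mul_sub_le (σ : StubPairing d) (i j : Fin n) :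
    σ.edgeCount i j * σ.edgeCount i j - σ.edgeCount i j ≤
      ∑ a ∈ (Finset.univ : Finset (Fin (d i))).offDiag, ∑ b : Fin (d j) × Fin (d j),
        if σ.1 ⟨i, a.1⟩ = ⟨j, b.1⟩ ∧ σ.1 ⟨i, a.2⟩ = ⟨j, b.2⟩ then 1 else 0 := by
  rw [edgeCount, ← Finset.offDiag_card]
  have : (Finset.univ.filter fun a : Fin (d i) => (σ.1 ⟨i, a⟩).1 = j).offDiag =
      (Finset.univ : Finset (Fin (d i))).offDiag.filter
        fun a => (σ.1 ⟨i, a.1⟩).1 = j ∧ (σ.1 ⟨i, a.2⟩).1 = j := by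
    ext a
    simp only [Finset.mem_offDiag, Finset.mem_filter, Finset.mem_univ, true_and]
    tauto
  rw [this, Finset.card_filter]
  refine Finset.sum_le_sum fun a _ => ?_
  split_ifs with h
  · obtain ⟨h1, h2⟩ := h
    rcases e1 : σ.1 ⟨i, a.1⟩ with ⟨k, b⟩
    rcases e2 : σ.1 ⟨i, a.2⟩ with ⟨l, c⟩
    rw [e1] at h1
    rw [e2] at h2
    dsimp only at h1 h2
    subst h1
    subst h2
    refine le_trans ?_ (Finset.single_le_sum (fun _ _ => Nat.zero_le _) (Finset.mem_univ (b, c)))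
    simp
  · exact Nat.zero_le _

lemma sum_edgeCount_mul_sub_le (d : Fin n → ℕ) {i j : Fin n} (hij : i ≠ j) :
    (∑ k, d k - 1) * ((∑ k, d k - 3) *
        ∑ σ : StubPairing d, (σ.edgeCount i j * σ.edgeCount i j - σ.edgeCount i j)) ≤
      (d i * d j) ^ 2 * Fintype.card (StubPairing d) := by
  have key : ∀ a ∈ (Finset.univ : Finset (Fin (d i))).offDiag, ∀ b : Fin (d j) × Fin (d j),
      (∑ k, d k - 1) * ((∑ k, d k - 3) * ∑ σ : StubPairing d,
        (if σ.1 ⟨i, a.1⟩ = ⟨j, b.1⟩ ∧ σ.1 ⟨i, a.2⟩ = ⟨j, b.2⟩ then 1 else 0)) ≤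
        Fintype.card (StubPairing d) := by
    intro a ha b
    have ha' : a.1 ≠ a.2 := by simpa using ha
    rw [← Finset.card_filter]
    have hne : ∀ (x : Fin (d i)) (y : Fin (d j)), (⟨i, x⟩ : Stub d) ≠ ⟨j, y⟩ :=
      fun x y h => hij (congrArg Sigma.fst h)
    have haa : (⟨i, a.1⟩ : Stub d) ≠ ⟨i, a.2⟩ := fun h => ha' (by simpa using h)
    by_cases h : b.1 = b.2
    · rw [Finset.filter_false_of_mem]
      · simp
      · rintro σ _ ⟨h1, h2⟩
        exact haa (σ.1.injective (by rw [h1, h2, h]))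
    · have hbb : (⟨j, b.1⟩ : Stub d) ≠ ⟨j, b.2⟩ := fun h' => h (by simpa using h')
      rw [← card_stub]
      exact (congrArg _ (Pairing.card_filter_apply_eq_and (hne a.1 b.1) haa.symm (hne a.2 b.1)
        (hne a.1 b.2).symm hbb.symm (hne a.2 b.2).symm)).trans_le
        (Pairing.card_filter_apply_eq (hne a.1 b.1)).le
  calc _ ≤ (∑ k, d k - 1) * ((∑ k, d k - 3) * ∑ σ : StubPairing d,
        ∑ a ∈ (Finset.univ : Finset (Fin (d i))).offDiag, ∑ b : Fin (d j) × Fin (d j),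
        if σ.1 ⟨i, a.1⟩ = ⟨j, b.1⟩ ∧ σ.1 ⟨i, a.2⟩ = ⟨j, b.2⟩ then 1 else 0) := by
        gcongr with σ
        exact edgeCount_mul_sub_le σ i j
    _ ≤ ∑ a ∈ (Finset.univ : Finset (Fin (d i))).offDiag, ∑ b : Fin (d j) × Fin (d j),
        Fintype.card (StubPairing d) := by
        rw [Finset.sum_comm, Finset.mul_sum, Finset.mul_sum]
        refine Finset.sum_le_sum fun a ha => ?_
        rw [Finset.sum_comm, Finset.mul_sum, Finset.mul_sum]
        exact Finset.sum_le_sum fun b _ => key a ha b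
    _ = (d i * d i - d i) * (d j * d j) * Fintype.card (StubPairing d) := by
        simp [Finset.offDiag_card, mul_assoc]
    _ ≤ (d i * d i) * (d j * d j) * Fintype.card (StubPairing d) := by
        gcongr
        exact Nat.sub_le _ _
    _ = _ := by ring

end StubPairing

/-! ### Removed edges and erased degrees. -/

section Removed

variable {n : ℕ}

lemma removedEdges_le (x : Fin n → Fin n → ℕ) (i j : Fin n) : removedEdges x i j ≤ x i j :=
  Nat.sub_le _ _

lemma removedEdges_le_mul_sub (x : Fin n → Fin n → ℕ) {i j : Fin n} (hij : i ≠ j) :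
    removedEdges x i j ≤ x i j * x i j - x i j := by
  rcases Nat.eq_zero_or_pos (x i j) with h | h
  · simp [removedEdges, h]
  · have hadj : (erasedGraph x).Adj i j := by
      simp [erasedGraph, hij, h]
    rw [removedEdges, if_pos hadj]
    obtain ⟨m, hm⟩ := Nat.exists_eq_add_of_lt h
    rw [zero_add] at hm
    rw [hm, ← Nat.mul_sub_one, Nat.add_sub_cancel]
    exact Nat.le_mul_of_pos_left m m.succ_pos

/-- Each neighbour in the erased graph accounts for exactly one kept stub. Symmetry of the
multiplicities matters: adjacency only says that one of `x i j`, `x j i` is positive, and the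
truncated subtraction needs the first. -/
lemma erasedDegree_add_removedStubs {d : Fin n → ℕ} (σ : StubPairing d) (i : Fin n) :
    erasedDegree σ.edgeCount i + removedStubs σ.edgeCount i = d i := by
  classical
  rw [← StubPairing.sum_edgeCount σ i, removedStubs, erasedDegree,
    ← SimpleGraph.card_neighborFinset_eq_degree, SimpleGraph.neighborFinset_eq_filter,
    Finset.card_filter, ← Finset.sum_add_distrib]
  refine Finset.sum_congr rfl fun j _ => ?_
  rw [removedEdges]
  by_cases h : (erasedGraph σ.edgeCount).Adj i j
  · have hpos : 0 < σ.edgeCount i j := by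
      have := h
      simp only [erasedGraph, SimpleGraph.fromRel_adj] at this
      rcases this.2 with h' | h'
      · exact h'
      · rwa [StubPairing.edgeCount_comm]
    simp only [if_pos h]
    lia
  · simp only [if_neg h]
    lia

end Removed

/-! ### Norm comparison and interpolation between two moment bounds. -/

/-- An `ℓ^r` norm is at most the `ℓ^a` norm if `a ≤ r`. -/
lemma sum_rpow_le_rpow_sum {ι : Type*} (s : Finset ι) {x : ι → ℝ} (hx : ∀ i ∈ s, 0 ≤ x i)
    {a r : ℝ} (ha : 0 < a) (har : a ≤ r) :
    ∑ i ∈ s, x i ^ r ≤ (∑ i ∈ s, x i ^ a) ^ (r / a) := by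
  have h0 : ∀ i ∈ s, 0 ≤ x i ^ a := fun i hi => Real.rpow_nonneg (hx i hi) _
  have hra : 1 ≤ r / a := (one_le_div ha).2 har
  calc ∑ i ∈ s, x i ^ r = ∑ i ∈ s, x i ^ a * (x i ^ a) ^ (r / a - 1) := by
        refine Finset.sum_congr rfl fun i hi => ?_
        rw [← Real.rpow_one_add' (h0 i hi) (by linarith), ← Real.rpow_mul (hx i hi)]
        congr 1
        field_simp
        ring
    _ ≤ ∑ i ∈ s, x i ^ a * (∑ j ∈ s, x j ^ a) ^ (r / a - 1) := by
        refine Finset.sum_le_sum fun i hi => mul_le_mul_of_nonneg_left ?_ (h0 i hi)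
        exact Real.rpow_le_rpow (h0 i hi) (Finset.single_le_sum h0 hi) (by linarith)
    _ = _ := by
        rw [← Finset.sum_mul, ← Real.rpow_one_add' (Finset.sum_nonneg h0) (by linarith)]
        congr 1
        ring

/-- Interpolation: `min x (x ^ 2) ≤ x ^ a`, using the first-moment bound `F` when `x ≥ 1` and the
second-moment bound `G` when `x ≤ 1`. The factor `6` absorbs the replacement of `L - 1` and `L - 3`
by `L`. -/
lemma le_six_mul_rpow_mul {E F G L N x a : ℝ} (hL : 4 ≤ L) (hx0 : 0 ≤ x) (hN0 : 0 ≤ N)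
    (hE0 : 0 ≤ E) (e1 : E ≤ F) (e2 : E ≤ G) (ha1 : 1 ≤ a) (ha2 : a ≤ 2)
    (h1 : (L - 1) * F ≤ x * L * N) (h2 : (L - 1) * ((L - 3) * G) ≤ (x * L) ^ 2 * N) :
    E ≤ 6 * x ^ a * N := by
  have hL0 : 0 < L := by linarith
  rcases le_total 1 x with h | h
  · have hxa : x ≤ x ^ a := by simpa using Real.rpow_le_rpow_of_exponent_le h ha1
    have h3 : (L - 1) * E ≤ x * L * N := (mul_le_mul_of_nonneg_left e1 (by linarith)).trans h1
    have h4 : E * L ≤ 6 * x * N * L := by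
      nlinarith [mul_nonneg (mul_nonneg hx0 hN0) hL0.le]
    exact (le_of_mul_le_mul_right h4 hL0).trans (by gcongr)
  · have hxa : x ^ 2 ≤ x ^ a := by
      rcases hx0.eq_or_lt with h0 | h0
      · rw [← h0, Real.zero_rpow (by linarith)]
        norm_num
      · simpa using Real.rpow_le_rpow_of_exponent_ge h0 h ha2
    have e3 : (L - 1) * ((L - 3) * E) ≤ (x * L) ^ 2 * N := by
      refine le_trans ?_ h2
      exact mul_le_mul_of_nonneg_left (mul_le_mul_of_nonneg_left e2 (by linarith)) (by linarith)
    have e4 : L ^ 2 ≤ 6 * ((L - 1) * (L - 3)) := by nlinarith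
    have h4 : E * L ^ 2 ≤ 6 * x ^ 2 * N * L ^ 2 := by
      calc E * L ^ 2 ≤ E * (6 * ((L - 1) * (L - 3))) := mul_le_mul_of_nonneg_left e4 hE0
        _ = 6 * ((L - 1) * ((L - 3) * E)) := by ring
        _ ≤ 6 * ((x * L) ^ 2 * N) := mul_le_mul_of_nonneg_left e3 (by norm_num)
        _ = _ := by ring
    exact (le_of_mul_le_mul_right h4 (by positivity)).trans (by gcongr)

/-! ### Mean bounds for fixed degrees. -/

namespace StubPairing

variable {n : ℕ} {d : Fin n → ℕ}

lemma sum_removedEdges_le (hL : 4 ≤ ∑ k, d k) {a : ℝ} (ha1 : 1 ≤ a) (ha2 : a ≤ 2) {i j : Fin n}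
    (hij : i ≠ j) :
    ∑ σ : StubPairing d, (removedEdges σ.edgeCount i j : ℝ) ≤
      6 * (d i * d j / ∑ k, (d k : ℝ)) ^ a * Fintype.card (StubPairing d) := by
  set N := Fintype.card (StubPairing d)
  have hLR : (4 : ℝ) ≤ ∑ k, (d k : ℝ) := by exact_mod_cast hL
  have h1 := sum_edgeCount_mul_le d i j
  have h2 := sum_edgeCount_mul_sub_le d hij
  set E := ∑ σ : StubPairing d, (removedEdges σ.edgeCount i j : ℝ) with hE
  have hE0 : 0 ≤ E := Finset.sum_nonneg fun _ _ => Nat.cast_nonneg _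
  have e1 : E ≤ ((∑ σ : StubPairing d, σ.edgeCount i j : ℕ) : ℝ) := by
    rw [hE]
    exact_mod_cast Finset.sum_le_sum fun (σ : StubPairing d) _ => removedEdges_le σ.edgeCount i j
  have e2 : E ≤ ((∑ σ : StubPairing d,
      (σ.edgeCount i j * σ.edgeCount i j - σ.edgeCount i j) : ℕ) : ℝ) := by
    rw [hE]
    exact_mod_cast Finset.sum_le_sum fun (σ : StubPairing d) _ =>
      removedEdges_le_mul_sub σ.edgeCount hij
  rw [← Nat.cast_le (α := ℝ)] at h1 h2
  rw [Nat.cast_mul, Nat.cast_sub (by lia)] at h1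
  rw [Nat.cast_mul, Nat.cast_mul, Nat.cast_sub (by lia), Nat.cast_sub (by lia)] at h2
  push_cast at h1 h2
  have hdx : (d i * d j : ℝ) = (d i * d j / ∑ k, (d k : ℝ)) * ∑ k, (d k : ℝ) := by
    rw [div_mul_cancel₀ _ (by linarith)]
  rw [hdx] at h1 h2
  push_cast at e1 e2
  exact le_six_mul_rpow_mul hLR (by positivity) (Nat.cast_nonneg _) hE0 e1 e2 ha1 ha2 h1 h2

/-- Every self-loop is removed, so only the first moment is available; the factor `2` comes from `L
≤ 2 * (L - 1)`. -/
lemma sum_removedEdges_self_le (hL : 4 ≤ ∑ k, d k) (i : Fin n) :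
    ∑ σ : StubPairing d, (removedEdges σ.edgeCount i i : ℝ) ≤
      2 * (d i ^ 2 / ∑ k, (d k : ℝ)) * Fintype.card (StubPairing d) := by
  set N := Fintype.card (StubPairing d)
  have hLR : (4 : ℝ) ≤ ∑ k, (d k : ℝ) := by exact_mod_cast hL
  have h1 := sum_edgeCount_mul_le d i i
  set E := ∑ σ : StubPairing d, (removedEdges σ.edgeCount i i : ℝ) with hE
  have hE0 : 0 ≤ E := Finset.sum_nonneg fun _ _ => Nat.cast_nonneg _
  have e1 : E ≤ ((∑ σ : StubPairing d, σ.edgeCount i i : ℕ) : ℝ) := by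
    rw [hE]
    exact_mod_cast Finset.sum_le_sum fun (σ : StubPairing d) _ => removedEdges_le σ.edgeCount i i
  rw [← Nat.cast_le (α := ℝ), Nat.cast_mul, Nat.cast_sub (by lia)] at h1
  set F := ((∑ σ : StubPairing d, σ.edgeCount i i : ℕ) : ℝ)
  push_cast at h1
  set L := ∑ k, (d k : ℝ)
  have hL0 : 0 < L := by linarith
  rw [mul_div_assoc', div_mul_eq_mul_div, le_div_iff₀ hL0]
  have : E * (L - 1) ≤ d i * d i * N := by nlinarith
  nlinarith

/-- Upper bound for the mean of `∑ i, d i ^ p * Y i` over all pairings. -/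
lemma sum_pow_mul_removedStubs_le (hL : 4 ≤ ∑ k, d k) {a : ℝ} (ha1 : 1 ≤ a) (ha2 : a ≤ 2)
    (p : ℕ) :
    ∑ σ : StubPairing d, ∑ i, (d i : ℝ) ^ p * (removedStubs σ.edgeCount i : ℝ) ≤
      (6 * (∑ k, (d k : ℝ)) ^ (-a) * ((∑ i, (d i : ℝ) ^ (p + a)) * ∑ j, (d j : ℝ) ^ a) +
        2 * (∑ k, (d k : ℝ))⁻¹ * ∑ i, (d i : ℝ) ^ ((p : ℝ) + 2)) *
        Fintype.card (StubPairing d) := by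
  set N := Fintype.card (StubPairing d)
  have hLR : (4 : ℝ) ≤ ∑ k, (d k : ℝ) := by exact_mod_cast hL
  set L := ∑ k, (d k : ℝ) with hLdef
  have hL0 : 0 < L := by linarith
  have hrow : ∀ i, ∑ σ : StubPairing d, (removedStubs σ.edgeCount i : ℝ) ≤
      (∑ j, 6 * (d i * d j / L) ^ a + 2 * (d i ^ 2 / L)) * N := by
    intro i
    simp only [removedStubs, Nat.cast_sum]
    rw [Finset.sum_comm, ← Finset.add_sum_erase _ _ (Finset.mem_univ i), add_comm, add_mul,
      Finset.sum_mul]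
    refine add_le_add ?_ (sum_removedEdges_self_le hL i)
    refine (Finset.sum_le_sum fun j hj => sum_removedEdges_le hL ha1 ha2
      (Finset.ne_of_mem_erase hj).symm).trans ?_
    exact Finset.sum_le_sum_of_subset_of_nonneg (Finset.erase_subset _ _)
      fun _ _ _ => by positivity
  calc _ = ∑ i, (d i : ℝ) ^ p * ∑ σ : StubPairing d, (removedStubs σ.edgeCount i : ℝ) := by
        rw [Finset.sum_comm]
        simp only [Finset.mul_sum]
    _ ≤ ∑ i, (d i : ℝ) ^ p * ((∑ j, 6 * (d i * d j / L) ^ a + 2 * (d i ^ 2 / L)) * N) := by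
        gcongr with i
        exact hrow i
    _ = _ := by
        rw [Finset.sum_mul_sum, Finset.mul_sum, Finset.mul_sum, ← Finset.sum_add_distrib,
          Finset.sum_mul]
        refine Finset.sum_congr rfl fun i _ => ?_
        rw [← mul_assoc, mul_add, Finset.mul_sum, Finset.mul_sum]
        congr 2
        · refine Finset.sum_congr rfl fun j _ => ?_
          rw [Real.div_rpow (by positivity) hL0.le, Real.mul_rpow (by positivity) (by positivity),
            Real.rpow_add' (by positivity) (by positivity), Real.rpow_neg hL0.le,
            Real.rpow_natCast]
          ring
        · rw [show (p : ℝ) + 2 = ((p + 2 : ℕ) : ℝ) by push_cast; ring, Real.rpow_natCast]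
          ring

/-- Upper bound for the mean of `∑ i < j, Z i j * d i * d j` over all pairings. -/
lemma sum_removedEdges_mul_mul_le (hL : 4 ≤ ∑ k, d k) {a : ℝ} (ha1 : 1 ≤ a) (ha2 : a ≤ 2) :
    ∑ σ : StubPairing d, ∑ i, ∑ j ∈ Finset.Ioi i,
        (removedEdges σ.edgeCount i j : ℝ) * (d i : ℝ) * (d j : ℝ) ≤
      6 * (∑ k, (d k : ℝ)) ^ (-a) * (∑ i, (d i : ℝ) ^ (1 + a)) ^ 2 *
        Fintype.card (StubPairing d) := by
  set N := Fintype.card (StubPairing d)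
  have hLR : (4 : ℝ) ≤ ∑ k, (d k : ℝ) := by exact_mod_cast hL
  set L := ∑ k, (d k : ℝ) with hLdef
  have hL0 : 0 < L := by linarith
  calc _ = ∑ i, ∑ j ∈ Finset.Ioi i, (d i * d j : ℝ) *
        ∑ σ : StubPairing d, (removedEdges σ.edgeCount i j : ℝ) := by
        rw [Finset.sum_comm]
        refine Finset.sum_congr rfl fun i _ => ?_
        rw [Finset.sum_comm]
        refine Finset.sum_congr rfl fun j _ => ?_
        rw [Finset.mul_sum]
        exact Finset.sum_congr rfl fun σ _ => by ring
    _ ≤ ∑ i, ∑ j ∈ Finset.Ioi i, (d i * d j : ℝ) * (6 * (d i * d j / L) ^ a * N) := by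
        gcongr with i _ j hj
        exact sum_removedEdges_le hL ha1 ha2 (Finset.mem_Ioi.1 hj).ne
    _ ≤ ∑ i, ∑ j, (d i * d j : ℝ) * (6 * (d i * d j / L) ^ a * N) := by
        refine Finset.sum_le_sum fun i _ => ?_
        exact Finset.sum_le_sum_of_subset_of_nonneg (Finset.subset_univ _)
          fun _ _ _ => by positivity
    _ = _ := by
        rw [sq, Finset.sum_mul_sum, Finset.mul_sum, Finset.sum_mul]
        refine Finset.sum_congr rfl fun i _ => ?_
        rw [Finset.mul_sum, Finset.sum_mul]
        refine Finset.sum_congr rfl fun j _ => ?_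
        rw [Real.div_rpow (by positivity) hL0.le, Real.mul_rpow (by positivity) (by positivity),
          Real.rpow_one_add' (by positivity) (by positivity),
          Real.rpow_one_add' (by positivity) (by positivity), Real.rpow_neg hL0.le]
        ring

/-- A difference of degree power sums is controlled by the removed stubs. -/
lemma abs_sum_pow_sub_sum_erasedDegree_pow_le (σ : StubPairing d) (q : ℕ) :
    |∑ i, (d i : ℝ) ^ q - ∑ i, (erasedDegree σ.edgeCount i : ℝ) ^ q| ≤
      q * ∑ i, (d i : ℝ) ^ (q - 1) * (removedStubs σ.edgeCount i : ℝ) := by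
  rw [← Finset.sum_sub_distrib, Finset.mul_sum]
  refine (Finset.abs_sum_le_sum_abs _ _).trans (Finset.sum_le_sum fun i _ => ?_)
  have h : (erasedDegree σ.edgeCount i : ℝ) + removedStubs σ.edgeCount i = d i := by
    exact_mod_cast erasedDegree_add_removedStubs σ i
  have h0 : (0 : ℝ) ≤ erasedDegree σ.edgeCount i := Nat.cast_nonneg _
  have h1 : (0 : ℝ) ≤ removedStubs σ.edgeCount i := Nat.cast_nonneg _
  have := abs_pow_sub_pow_le (d i : ℝ) (erasedDegree σ.edgeCount i) q
  rw [abs_of_nonneg (by linarith : (0 : ℝ) ≤ d i - erasedDegree σ.edgeCount i),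
    abs_of_nonneg h0, abs_of_nonneg (by positivity : (0 : ℝ) ≤ d i),
    max_eq_left (by linarith)] at this
  refine this.trans (le_of_eq ?_)
  rw [← h]
  ring

/-! ### Growth of the mean bounds in `n`. -/

section Growth

variable {a c C : ℝ}

/-- The mean of `∑ i, d i ^ p * Y i` under linear bounds on the moments of the degrees. -/
lemma sum_pow_mul_removedStubs_le_rpow (ha1 : 1 ≤ a) (ha2 : a ≤ 2) (hc : 0 < c) (hC : 0 < C)
    (hn : 0 < n) (hL : 4 ≤ ∑ k, d k) (hlow : c * n ≤ ∑ k, (d k : ℝ))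
    (hup : ∑ k, (d k : ℝ) ^ a ≤ C * n) (p : ℕ) :
    ∑ σ : StubPairing d, ∑ i, (d i : ℝ) ^ p * (removedStubs σ.edgeCount i : ℝ) ≤
      ((6 * c ^ (-a) * (C ^ ((p + a) / a) * C) + 2 * c⁻¹ * C ^ ((p + 2) / a)) *
        (n : ℝ) ^ (p / a + 2 - a)) * Fintype.card (StubPairing d) := by
  have hn0 : (0 : ℝ) < n := by exact_mod_cast hn
  have hn1 : (1 : ℝ) ≤ n := by exact_mod_cast hn
  have ha0 : 0 < a := by linarith
  have hcn : 0 < c * n := by positivity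
  have hp0 : (0 : ℝ) ≤ p := by positivity
  have hd : ∀ i ∈ (Finset.univ : Finset (Fin n)), (0 : ℝ) ≤ d i := fun _ _ => by positivity
  have hW0 : 0 ≤ ∑ k, (d k : ℝ) ^ a := Finset.sum_nonneg fun _ _ => by positivity
  refine (sum_pow_mul_removedStubs_le hL ha1 ha2 p).trans ?_
  refine mul_le_mul_of_nonneg_right ?_ (Nat.cast_nonneg _)
  have s1 : ∑ i, (d i : ℝ) ^ (p + a) ≤ (C * n) ^ ((p + a) / a) :=
    (sum_rpow_le_rpow_sum _ hd ha0 (by linarith)).trans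
      (Real.rpow_le_rpow hW0 hup (by positivity))
  have s2 : ∑ i, (d i : ℝ) ^ ((p : ℝ) + 2) ≤ (C * n) ^ ((p + 2) / a) :=
    (sum_rpow_le_rpow_sum _ hd ha0 (by linarith)).trans
      (Real.rpow_le_rpow hW0 hup (by positivity))
  have s3 : (∑ k, (d k : ℝ)) ^ (-a) ≤ (c * n) ^ (-a) :=
    Real.rpow_le_rpow_of_nonpos hcn hlow (by linarith)
  have s4 : (∑ k, (d k : ℝ))⁻¹ ≤ (c * n)⁻¹ := inv_anti₀ hcn hlow
  calc _ ≤ 6 * (c * n) ^ (-a) * ((C * n) ^ ((p + a) / a) * (C * n)) +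
        2 * (c * n)⁻¹ * (C * n) ^ ((p + 2) / a) := by gcongr
    _ = 6 * c ^ (-a) * (C ^ ((p + a) / a) * C) * (n : ℝ) ^ (p / a + 2 - a) +
        2 * c⁻¹ * C ^ ((p + 2) / a) * (n : ℝ) ^ ((p + 2) / a - 1) := by
        rw [Real.mul_rpow hc.le hn0.le, Real.mul_rpow hC.le hn0.le, Real.mul_rpow hC.le hn0.le,
          show p / a + 2 - a = -a + (p + a) / a + 1 by field_simp; ring,
          Real.rpow_add hn0, Real.rpow_add hn0, Real.rpow_sub hn0, Real.rpow_one]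
        field_simp
    _ ≤ 6 * c ^ (-a) * (C ^ ((p + a) / a) * C) * (n : ℝ) ^ (p / a + 2 - a) +
        2 * c⁻¹ * C ^ ((p + 2) / a) * (n : ℝ) ^ (p / a + 2 - a) := by
        -- Equivalent to `(a - 1) * (2 - a) ≥ 0`; it makes the self-loop exponent `(p + 2) / a - 1`
        -- at most the main one.
        have : 2 / a ≤ 3 - a := by
          rw [div_le_iff₀ ha0]
          nlinarith
        have : (n : ℝ) ^ ((p + 2) / a - 1) ≤ (n : ℝ) ^ (p / a + 2 - a) := by
          refine Real.rpow_le_rpow_of_exponent_le hn1 ?_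
          rw [add_div]
          linarith
        gcongr
    _ = _ := by ring

/-- The mean of `∑ i < j, Z i j * d i * d j` under linear bounds on the moments of the degrees. -/
lemma sum_removedEdges_mul_mul_le_rpow (ha1 : 1 ≤ a) (ha2 : a ≤ 2) (hc : 0 < c) (hC : 0 < C)
    (hn : 0 < n) (hL : 4 ≤ ∑ k, d k) (hlow : c * n ≤ ∑ k, (d k : ℝ))
    (hup : ∑ k, (d k : ℝ) ^ a ≤ C * n) :
    ∑ σ : StubPairing d, ∑ i, ∑ j ∈ Finset.Ioi i,
        (removedEdges σ.edgeCount i j : ℝ) * (d i : ℝ) * (d j : ℝ) ≤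
      ((6 * c ^ (-a) * (C ^ ((1 + a) / a)) ^ 2) *
        (n : ℝ) ^ (2 / a + 2 - a)) * Fintype.card (StubPairing d) := by
  have hn0 : (0 : ℝ) < n := by exact_mod_cast hn
  have ha0 : 0 < a := by linarith
  have hcn : 0 < c * n := by positivity
  have hd : ∀ i ∈ (Finset.univ : Finset (Fin n)), (0 : ℝ) ≤ d i := fun _ _ => by positivity
  have hW0 : 0 ≤ ∑ k, (d k : ℝ) ^ a := Finset.sum_nonneg fun _ _ => by positivity
  refine (sum_removedEdges_mul_mul_le hL ha1 ha2).trans ?_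
  refine mul_le_mul_of_nonneg_right ?_ (Nat.cast_nonneg _)
  have s1 : ∑ i, (d i : ℝ) ^ (1 + a) ≤ (C * n) ^ ((1 + a) / a) :=
    (sum_rpow_le_rpow_sum _ hd ha0 (by linarith)).trans
      (Real.rpow_le_rpow hW0 hup (by positivity))
  have s3 : (∑ k, (d k : ℝ)) ^ (-a) ≤ (c * n) ^ (-a) :=
    Real.rpow_le_rpow_of_nonpos hcn hlow (by linarith)
  calc _ ≤ 6 * (c * n) ^ (-a) * ((C * n) ^ ((1 + a) / a)) ^ 2 := by gcongr
    _ = _ := by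
        rw [Real.mul_rpow hc.le hn0.le, Real.mul_rpow hC.le hn0.le,
          show 2 / a + 2 - a = -a + (1 + a) / a + (1 + a) / a by field_simp; ring,
          Real.rpow_add hn0, Real.rpow_add hn0]
        ring

end Growth

end StubPairing

/-! ### Moments of regularly varying laws. -/

/-- Dyadic decay of a regularly varying tail, at any rate below its exponent. -/
lemma HasRegularlyVaryingTail.exists_dyadic_bound {ν : Measure ℕ} {γ : ℝ}
    (h : HasRegularlyVaryingTail ν γ) {b : ℝ} (hb : b < γ) :
    ∃ t : ℝ, 1 ≤ t ∧ (∀ m : ℕ, ν.real {k : ℕ | 2 ^ m * t < (k : ℝ)} ≤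
      ((2 : ℝ) ^ (-b)) ^ m * ν.real {k : ℕ | t < (k : ℝ)}) ∧ 0 < ν.real {k : ℕ | t < (k : ℝ)} := by
  obtain ⟨L, ⟨⟨a, ha, -⟩, hL⟩, hν⟩ := h
  -- Since `L (2 * t) / L t → 1`, the ratio is eventually below `2 ^ (γ - b)`; from then on each
  -- doubling shrinks the tail by a factor at most `2 ^ (-b)`.
  have hlt : (1 : ℝ) < 2 ^ (γ - b) := Real.one_lt_rpow (by norm_num) (by linarith)
  obtain ⟨t₀, ht₀⟩ := eventually_atTop.1 ((hL 2 two_pos).eventually_lt_const hlt)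
  set t := max 1 (max a t₀) with ht
  have ht1 : 1 ≤ t := le_max_left _ _
  have hta : a ≤ t := (le_max_left _ _).trans (le_max_right _ _)
  have htt : t₀ ≤ t := (le_max_right _ _).trans (le_max_right _ _)
  refine ⟨t, ht1, fun m => ?_, ?_⟩
  · induction m with
    | zero => simp
    | succ m ih =>
      have hm : t ≤ 2 ^ m * t := le_mul_of_one_le_left (by linarith) (one_le_pow₀ (by norm_num))
      have hpos : 0 < 2 ^ m * t := by positivity
      have hLpos := ha _ (hta.trans hm)
      have hstep : L (2 * (2 ^ m * t)) ≤ 2 ^ (γ - b) * L (2 ^ m * t) :=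
        ((div_lt_iff₀ hLpos).1 (ht₀ _ (htt.trans hm))).le
      calc ν.real {k : ℕ | 2 ^ (m + 1) * t < (k : ℝ)}
          = L (2 * (2 ^ m * t)) * (2 * (2 ^ m * t)) ^ (-γ) := by
            rw [← hν _ (by positivity), pow_succ']
            simp only [mul_assoc]
        _ ≤ (2 ^ (γ - b) * L (2 ^ m * t)) * (2 * (2 ^ m * t)) ^ (-γ) := by gcongr
        _ = (2 : ℝ) ^ (-b) * ν.real {k : ℕ | 2 ^ m * t < (k : ℝ)} := by
            rw [hν _ hpos, Real.mul_rpow two_pos.le hpos.le, show -b = (γ - b) + -γ by ring,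
              Real.rpow_add two_pos]
            ring
        _ ≤ _ := by
            rw [pow_succ', mul_assoc]
            gcongr
  · rw [hν t (by linarith)]
    have := ha t hta
    positivity

/-- A law with regularly varying tail of exponent `γ` has finite moments of all orders below `γ`. -/
lemma HasRegularlyVaryingTail.integrable_rpow {ν : Measure ℕ} [IsFiniteMeasure ν] {γ : ℝ}
    (h : HasRegularlyVaryingTail ν γ) {a : ℝ} (ha0 : 0 ≤ a) (ha : a < γ) :
    Integrable (fun k : ℕ => ((k : ℝ) + 1) ^ a) ν := by
  obtain ⟨b, hab, hb⟩ := exists_between ha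
  obtain ⟨t, ht1, hdec, -⟩ := h.exists_dyadic_bound hb
  have ht0 : 0 < t := by linarith
  refine ⟨Measurable.aestronglyMeasurable (by fun_prop), ?_⟩
  rw [hasFiniteIntegral_iff_enorm]
  -- Dyadic decomposition: if `2 ^ m * t < k ≤ 2 ^ (m + 1) * t`, then `k + 1 ≤ 2 ^ m * (4 * t)`
  -- because `t ≥ 1`. The resulting series is geometric with ratio `2 ^ (a - b) < 1`.
  have hpt : ∀ k : ℕ, ‖((k : ℝ) + 1) ^ a‖ₑ ≤ ENNReal.ofReal ((2 * t) ^ a) +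
      ∑' m : ℕ, ({k : ℕ | 2 ^ m * t < (k : ℝ)}.indicator
        (fun _ => ENNReal.ofReal ((2 ^ m * (4 * t)) ^ a)) k) := by
    intro k
    rw [Real.enorm_eq_ofReal (by positivity)]
    by_cases hk : (k : ℝ) ≤ t
    · refine le_add_right (ENNReal.ofReal_le_ofReal ?_)
      gcongr
      linarith
    · push Not at hk
      obtain ⟨m, hm1, hm2⟩ : ∃ m : ℕ, 2 ^ m * t < (k : ℝ) ∧ (k : ℝ) ≤ 2 ^ (m + 1) * t := by
        have hex : ∃ m : ℕ, (k : ℝ) ≤ 2 ^ m * t := by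
          obtain ⟨m, hm⟩ := pow_unbounded_of_one_lt (k : ℝ) (one_lt_two (α := ℝ))
          exact ⟨m, hm.le.trans (le_mul_of_one_le_right (by positivity) ht1)⟩
        classical
        have hne : Nat.find hex ≠ 0 := fun h0 => by
          have := Nat.find_spec hex
          rw [h0] at this
          simp only [pow_zero, one_mul] at this
          linarith
        obtain ⟨m, hm⟩ := Nat.exists_eq_succ_of_ne_zero hne
        refine ⟨m, ?_, ?_⟩
        · exact not_le.1 (Nat.find_min hex (by lia))
        · have := Nat.find_spec hex
          rwa [hm] at this
      refine le_add_left (le_trans ?_ (ENNReal.le_tsum m))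
      rw [Set.indicator_of_mem (by exact hm1)]
      refine ENNReal.ofReal_le_ofReal ?_
      gcongr
      have : (1 : ℝ) ≤ 2 ^ m * t := by
        have := one_le_pow₀ (one_le_two (α := ℝ)) (n := m)
        nlinarith
      rw [pow_succ] at hm2
      linarith
  refine (lintegral_mono hpt).trans_lt ?_
  rw [lintegral_add_left measurable_const, lintegral_const, lintegral_tsum
    (fun m => (measurable_const.indicator .of_discrete).aemeasurable)]
  refine ENNReal.add_lt_top.2 ⟨by finiteness, ?_⟩
  set F := ν.real {k : ℕ | t < (k : ℝ)}
  have hbound : ∀ m : ℕ, ∫⁻ k, {k : ℕ | 2 ^ m * t < (k : ℝ)}.indicator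
      (fun _ => ENNReal.ofReal ((2 ^ m * (4 * t)) ^ a)) k ∂ν ≤
      ENNReal.ofReal (((2 : ℝ) ^ (a - b)) ^ m * ((4 * t) ^ a * F)) := by
    intro m
    rw [lintegral_indicator_const .of_discrete, ← ofReal_measureReal,
      ← ENNReal.ofReal_mul (by positivity)]
    refine ENNReal.ofReal_le_ofReal ?_
    calc _ ≤ (2 ^ m * (4 * t)) ^ a * (((2 : ℝ) ^ (-b)) ^ m * F) := by
          gcongr
          exact hdec m
      _ = _ := by
        rw [Real.mul_rpow (by positivity) (by positivity), ← Real.rpow_natCast_mul two_pos.le,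
          ← Real.rpow_mul_natCast two_pos.le, ← Real.rpow_mul_natCast two_pos.le,
          show (a - b) * m = m * a + -b * m by ring, Real.rpow_add two_pos]
        ring
  refine (ENNReal.tsum_le_tsum hbound).trans_lt ?_
  have hsum : Summable fun m : ℕ => ((2 : ℝ) ^ (a - b)) ^ m * ((4 * t) ^ a * F) :=
    (summable_geometric_of_lt_one (by positivity)
      (Real.rpow_lt_one_of_one_lt_of_neg one_lt_two (by linarith))).mul_right _
  exact hsum.tsum_ofReal_lt_top

/-! ### Laws of large numbers for the sample. -/

section Sample

variable {Ω : Type*} [MeasurableSpace Ω] {P : Measure Ω}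
  {ν : Measure ℕ} {S : ℕ → Ω → ℕ}

lemma strong_law_comp (hS : iIndepFun S P) (hSν : ∀ i, HasLaw (S i) ν P) {g : ℕ → ℝ}
    (hg : Integrable g ν) :
    ∀ᵐ ω ∂P, Tendsto (fun n : ℕ => (∑ i ∈ Finset.range n, g (S i ω)) / n) atTop
      (𝓝 (∫ k, g k ∂ν)) := by
  have hgm : Measurable g := .of_discrete
  have hid : ∀ i, IdentDistrib (g ∘ S i) (g ∘ S 0) P P := fun i =>
    IdentDistrib.comp ⟨(hSν i).aemeasurable, (hSν 0).aemeasurable,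
      (hSν i).map_eq.trans (hSν 0).map_eq.symm⟩ hgm
  have hint : Integrable (g ∘ S 0) P := by
    have := hg
    rw [← (hSν 0).map_eq] at this
    exact this.comp_aemeasurable (hSν 0).aemeasurable
  have hmean : ∫ ω, (g ∘ S 0) ω ∂P = ∫ k, g k ∂ν := by
    rw [← (hSν 0).map_eq, integral_map (hSν 0).aemeasurable hgm.aestronglyMeasurable]
    rfl
  have := strong_law_ae_real (fun i => g ∘ S i) hint
    (fun i j hij => (hS.indepFun hij).comp hgm hgm) hid
  rw [hmean] at this
  exact this

/-- With high probability, the `a`-th moment sum of a sample with regularly varying tail is at most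
linear, and its sum is at least linear. -/
lemma exists_tendsto_measure_compl_moment_bounds [IsProbabilityMeasure P] {γ : ℝ}
    (hν : HasRegularlyVaryingTail ν γ) (hS : iIndepFun S P) (hSν : ∀ i, HasLaw (S i) ν P) {a : ℝ} (ha1 : 1 ≤ a) (ha : a < γ) :
    ∃ c C : ℝ, 0 < c ∧ 0 < C ∧ Tendsto (fun n : ℕ => P {ω |
      ¬ (∑ i ∈ Finset.range n, ((S i ω : ℝ) + 1) ^ a ≤ C * n ∧
        c * n ≤ ∑ i ∈ Finset.range n, (S i ω : ℝ))}) atTop (𝓝 0) := by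
  have hνP : IsProbabilityMeasure ν := by
    rw [← (hSν 0).map_eq]
    exact Measure.isProbabilityMeasure_map (hSν 0).aemeasurable
  -- The moment of `k + 1` rather than `k` leaves room for the parity correction of the last degree.
  have hga := hν.integrable_rpow (by linarith) ha
  have hg1 : Integrable (fun k : ℕ => (k : ℝ)) ν := by
    refine (hν.integrable_rpow zero_le_one (by linarith)).mono'
      (Measurable.aestronglyMeasurable (by fun_prop)) (.of_forall fun k => ?_)
    rw [Real.norm_of_nonneg (by positivity), Real.rpow_one]
    linarith
  set A := ∫ k : ℕ, ((k : ℝ) + 1) ^ a ∂ν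
  set B := ∫ k : ℕ, (k : ℝ) ∂ν with hB
  have hA : 0 ≤ A := integral_nonneg fun k => by positivity
  have hBpos : 0 < B := by
    obtain ⟨t, ht1, -, ht⟩ := hν.exists_dyadic_bound ha
    rw [hB, integral_pos_iff_support_of_nonneg (fun k => by positivity) hg1]
    refine lt_of_lt_of_le (ENNReal.toReal_pos_iff.1 ht).1 (measure_mono fun k hk => ?_)
    have hk' : t < (k : ℝ) := hk
    exact (by linarith : (0 : ℝ) < k).ne'
  refine ⟨B / 2, A + 1, by positivity, by positivity, ?_⟩
  -- Almost surely the bad event eventually fails; dominated convergence of its indicators turns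
  -- this into vanishing probability.
  have hae : ∀ᵐ ω ∂P, Tendsto (fun n : ℕ => Set.indicator {ω |
      ¬ (∑ i ∈ Finset.range n, ((S i ω : ℝ) + 1) ^ a ≤ (A + 1) * n ∧
        B / 2 * n ≤ ∑ i ∈ Finset.range n, (S i ω : ℝ))} (fun _ => (1 : ENNReal)) ω)
      atTop (𝓝 0) := by
    filter_upwards [strong_law_comp hS hSν hga, strong_law_comp hS hSν hg1] with ω h1 h2
    refine tendsto_const_nhds.congr' ?_
    filter_upwards [h1.eventually_lt_const (lt_add_one A),
      h2.eventually_const_lt (half_lt_self hBpos), eventually_gt_atTop 0] with n hn1 hn2 hn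
    have hn' : (0 : ℝ) < n := by exact_mod_cast hn
    rw [div_lt_iff₀ hn'] at hn1
    rw [lt_div_iff₀ hn'] at hn2
    rw [Set.indicator_of_notMem]
    simpa using ⟨hn1.le, hn2.le⟩
  have hmeas : ∀ n : ℕ, NullMeasurableSet {ω |
      ¬ (∑ i ∈ Finset.range n, ((S i ω : ℝ) + 1) ^ a ≤ (A + 1) * n ∧
        B / 2 * n ≤ ∑ i ∈ Finset.range n, (S i ω : ℝ))} P := by
    intro n
    have hSm : ∀ (g : ℕ → ℝ), AEMeasurable (fun ω => ∑ i ∈ Finset.range n, g (S i ω)) P :=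
      fun g => Finset.aemeasurable_fun_sum _ fun i _ =>
        (Measurable.of_discrete (f := g)).comp_aemeasurable (hSν i).aemeasurable
    exact ((nullMeasurableSet_le (hSm fun k => ((k : ℝ) + 1) ^ a) aemeasurable_const).inter
      (nullMeasurableSet_le aemeasurable_const (hSm fun k => (k : ℝ)))).compl
  have hlim := tendsto_lintegral_of_dominated_convergence' (μ := P) (fun _ => (1 : ENNReal))
    (fun n => (aemeasurable_const.indicator₀ (hmeas n)))
    (fun n => .of_forall fun ω => Set.indicator_le_self' (fun _ _ => zero_le) ω) (by simp) hae
  simp only [lintegral_zero] at hlim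
  refine hlim.congr fun n => ?_
  rw [lintegral_indicator_const₀ (hmeas n), one_mul]

end Sample

/-! ### From fixed to random degrees. -/

open Classical in
lemma tsum_cmProb_le {n : ℕ} (d : Fin n → ℕ) (B : (Fin n → Fin n → ℕ) → Prop) {β : ℝ}
    (hβ : 0 ≤ β)
    (h : ((Finset.univ.filter fun σ : StubPairing d => B σ.edgeCount).card : ℝ) ≤
      β * Fintype.card (StubPairing d)) :
    ∑' x, (if B x then ENNReal.ofReal (cmProb d x) else 0) ≤ ENNReal.ofReal β := by
  set s : Finset (Fin n → Fin n → ℕ) :=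
    Finset.univ.image fun σ : StubPairing d => σ.edgeCount with hs
  have hcm : ∀ x, 0 ≤ cmProb d x := fun x => by unfold cmProb; positivity
  rw [tsum_eq_sum (s := s), ← Finset.sum_filter, ← ENNReal.ofReal_sum_of_nonneg fun x _ => hcm x]
  · refine ENNReal.ofReal_le_ofReal ?_
    simp only [cmProb]
    rw [← Finset.sum_div]
    refine div_le_of_le_mul₀ (Nat.cast_nonneg _) hβ (le_trans (le_of_eq ?_) h)
    rw [Finset.card_eq_sum_card_fiberwise
      (s := Finset.univ.filter fun σ : StubPairing d => B σ.edgeCount)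
      (f := fun σ : StubPairing d => σ.edgeCount) (t := s.filter B), Nat.cast_sum]
    · refine Finset.sum_congr rfl fun x hx => ?_
      rw [Finset.filter_filter]
      congr 2
      ext σ
      simp only [Finset.mem_filter, Finset.mem_univ, true_and]
      exact ⟨fun hσ => ⟨hσ ▸ (Finset.mem_filter.1 hx).2, hσ⟩, fun hσ => hσ.2⟩
    · intro σ hσ
      simp only [hs, Finset.coe_filter, Finset.mem_image, Finset.mem_univ, true_and,
        Set.mem_ofPred_eq] at hσ ⊢
      exact ⟨⟨σ, rfl⟩, hσ⟩
  · intro x hx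
    have : (Finset.univ.filter fun σ : StubPairing d => σ.edgeCount = x) = ∅ := by
      rw [Finset.filter_eq_empty_iff]
      intro σ _ hσ
      exact hx (Finset.mem_image.2 ⟨σ, Finset.mem_univ _, hσ⟩)
    have h0 : cmProb d x = 0 := by
      unfold cmProb
      convert zero_div _
      rw [Nat.cast_eq_zero, Finset.card_eq_zero, ← this]
    simp [h0]

/-- The fibres of `D` are disjoint and null measurable, so their masses add up to at most the total
mass. -/
lemma tsum_measure_eq_le_one {Ω E : Type*} [MeasurableSpace Ω] {P : Measure Ω}
    [IsProbabilityMeasure P] [Countable E] [MeasurableSpace E] [MeasurableSingletonClass E]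
    {D : Ω → E} (hD : AEMeasurable D P) : ∑' d, P {ω | D ω = d} ≤ 1 := by
  have h := tsum_meas_le_meas_iUnion_of_disjoint₀ P
    (As := fun d => {ω | D ω = d}) (fun d => hD.nullMeasurable (measurableSet_singleton d))
    (fun d e hde => (Set.disjoint_left.2 fun ω h1 h2 => hde (h1.symm.trans h2)).aedisjoint)
  exact h.trans prob_le_one

/-- A bound for the probability of an event about the configuration model that is uniform over
a set of degree sequences holds for random degrees restricted to this set. -/
lemma IsConfigurationModel.measure_le {Ω : Type*} [MeasurableSpace Ω] {P : Measure Ω}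
    [IsProbabilityMeasure P] {n : ℕ} {D : Ω → Fin n → ℕ} {X : Ω → Fin n → Fin n → ℕ}
    (hX : IsConfigurationModel P D X) (hD : AEMeasurable D P) (G : (Fin n → ℕ) → Prop)
    (B : (Fin n → ℕ) → (Fin n → Fin n → ℕ) → Prop) [∀ d, DecidablePred (B d)] {β : ℝ}
    (hβ : 0 ≤ β)
    (h : ∀ d, G d → ((Finset.univ.filter fun σ : StubPairing d => B d σ.edgeCount).card : ℝ) ≤
      β * Fintype.card (StubPairing d)) :
    P {ω | G (D ω) ∧ B (D ω) (X ω)} ≤ ENNReal.ofReal β := by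
  classical
  -- There are countably many values `(d, x)`, so a union bound over them brings in the conditional
  -- law, with no measurability of the event itself.
  have hsub : {ω | G (D ω) ∧ B (D ω) (X ω)} ⊆
      ⋃ d, ⋃ x, {ω | G d ∧ B d x ∧ D ω = d ∧ X ω = x} := by
    intro ω hω
    simp only [Set.mem_iUnion]
    exact ⟨D ω, X ω, hω.1, hω.2, rfl, rfl⟩
  have hfix : ∀ d, ∑' x, P {ω | G d ∧ B d x ∧ D ω = d ∧ X ω = x} ≤
      P {ω | D ω = d} * ENNReal.ofReal β := by
    intro d
    by_cases hG : G d
    · refine le_trans ?_ (mul_le_mul_right (tsum_cmProb_le d (B d) hβ (by convert h d hG)) _)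
      rw [← ENNReal.tsum_mul_left]
      refine ENNReal.tsum_le_tsum fun x => ?_
      by_cases hB : B d x
      · simp only [hG, hB, true_and, if_true]
        rw [← ofReal_measureReal (s := {ω | D ω = d ∧ X ω = x}), hX.law,
          ENNReal.ofReal_mul measureReal_nonneg, ofReal_measureReal]
      · simp [hB]
    · simp [hG]
  calc P {ω | G (D ω) ∧ B (D ω) (X ω)} ≤
      ∑' d, ∑' x, P {ω | G d ∧ B d x ∧ D ω = d ∧ X ω = x} :=
        (measure_mono hsub).trans ((measure_iUnion_le _).trans
          (ENNReal.tsum_le_tsum fun d => measure_iUnion_le _))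
    _ ≤ ∑' d, P {ω | D ω = d} * ENNReal.ofReal β := ENNReal.tsum_le_tsum hfix
    _ = (∑' d, P {ω | D ω = d}) * ENNReal.ofReal β := ENNReal.tsum_mul_right
    _ ≤ _ := mul_le_of_le_one_left' (tsum_measure_eq_le_one hD)

/-- Markov's inequality for the uniform law on `ι`. -/
lemma card_filter_le_of_sum_le {ι : Type*} [Fintype ι] {T : ι → ℝ} (hT : ∀ i, 0 ≤ T i)
    {M η : ℝ} (hη : 0 < η) (h : ∑ i, T i ≤ M * Fintype.card ι) [DecidablePred fun i => η ≤ T i] :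
    ((Finset.univ.filter fun i => η ≤ T i).card : ℝ) ≤ M / η * Fintype.card ι := by
  rw [div_mul_eq_mul_div, le_div_iff₀ hη]
  refine le_trans ?_ h
  rw [← nsmul_eq_mul]
  exact (Finset.card_nsmul_le_sum _ _ _ fun i hi => (Finset.mem_filter.1 hi).2).trans
    (Finset.sum_le_sum_of_subset_of_nonneg (Finset.filter_subset _ _) fun i _ _ => hT i)

lemma le_evenDegrees {n : ℕ} (d : Fin n → ℕ) (i : Fin n) : d i ≤ evenDegrees d i := by
  unfold evenDegrees
  split_ifs <;> lia

lemma evenDegrees_le {n : ℕ} (d : Fin n → ℕ) (i : Fin n) : evenDegrees d i ≤ d i + 1 := by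
  unfold evenDegrees
  split_ifs <;> lia

/-! ### Choice of `a` and Markov's inequality. -/

section Main

variable {Ω : Type*} [MeasurableSpace Ω] {P : Measure Ω} [IsProbabilityMeasure P]
  {γ : ℝ} {ν : Measure ℕ} {S : ℕ → Ω → ℕ} {D : (n : ℕ) → Ω → Fin n → ℕ}
  {X : (n : ℕ) → Ω → Fin n → Fin n → ℕ}

/-- A functional of the configuration model whose mean, given degrees with linear sum and linear
`a`-th moment sum, is `O(n ^ θ a)`, is of order at most `n ^ (θ γ + δ)` in probability. -/
lemma tendstoInMeasure_div_rpow (hγ1 : 1 < γ) (hγ2 : γ < 2) (hν : HasRegularlyVaryingTail ν γ)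
    (hS : iIndepFun S P) (hSν : ∀ i, HasLaw (S i) ν P)
    (hD : ∀ n ω, D n ω = evenDegrees fun i : Fin n => S i ω)
    (hX : ∀ n, IsConfigurationModel P (D n) (X n))
    (T : (n : ℕ) → (Fin n → ℕ) → (Fin n → Fin n → ℕ) → ℝ) (hT0 : ∀ n d x, 0 ≤ T n d x)
    {θ : ℝ → ℝ} (hθ : ContinuousAt θ γ)
    (hT : ∀ a c C : ℝ, 1 ≤ a → a ≤ 2 → 0 < c → 0 < C → ∃ K : ℝ, 0 ≤ K ∧
      ∀ (n : ℕ) (d : Fin n → ℕ), 0 < n → 4 ≤ ∑ k, d k → c * n ≤ ∑ k, (d k : ℝ) →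
        ∑ k, (d k : ℝ) ^ a ≤ C * n → ∑ σ : StubPairing d, T n d σ.edgeCount ≤
          (K * (n : ℝ) ^ θ a) * Fintype.card (StubPairing d))
    {δ : ℝ} (hδ : 0 < δ) :
    TendstoInMeasure P (fun (n : ℕ) ω => T n (D n ω) (X n ω) / (n : ℝ) ^ (θ γ + δ)) atTop
      (fun _ => (0 : ℝ)) := by
  classical
  -- Approach `γ` from the left: `a < γ` keeps the `a`-th moment finite, while continuity of `θ`
  -- keeps the loss in the exponent below `δ`.
  obtain ⟨a, ⟨hθa, ha1⟩, haγ⟩ : ∃ a, (θ a < θ γ + δ ∧ 1 < a) ∧ a < γ := by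
    have h1 : ∀ᶠ a in 𝓝[<] γ, θ a < θ γ + δ :=
      (hθ.eventually_lt_const (by linarith)).filter_mono nhdsWithin_le_nhds
    have h2 : ∀ᶠ a in 𝓝[<] γ, 1 < a := (lt_mem_nhds hγ1).filter_mono nhdsWithin_le_nhds
    exact ((h1.and h2).and self_mem_nhdsWithin).exists
  obtain ⟨c, C, hc, hC, hbad⟩ := exists_tendsto_measure_compl_moment_bounds hν hS hSν ha1.le haγ
  obtain ⟨K, hK0, hK⟩ := hT a c C ha1.le (by linarith) hc hC
  have hDm : ∀ n, AEMeasurable (D n) P := by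
    intro n
    have : AEMeasurable (fun ω => fun i : Fin n => S i ω) P :=
      aemeasurable_pi_lambda _ fun i => (hSν i).aemeasurable
    rw [show D n = fun ω => evenDegrees fun i : Fin n => S i ω from funext (hD n)]
    exact (Measurable.of_discrete (f := evenDegrees)).comp_aemeasurable this
  rw [tendstoInMeasure_iff_norm]
  intro ε hε
  have hlim : Tendsto (fun n : ℕ => ENNReal.ofReal
      (K * (n : ℝ) ^ θ a / (ε * (n : ℝ) ^ (θ γ + δ)))) atTop (𝓝 0) := by
    have h1 : Tendsto (fun n : ℕ => K / ε * (n : ℝ) ^ (-(θ γ + δ - θ a))) atTop (𝓝 0) := by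
      simpa using ((tendsto_rpow_neg_atTop (sub_pos.2 hθa)).comp
        tendsto_natCast_atTop_atTop).const_mul (K / ε)
    rw [← ENNReal.ofReal_zero]
    refine ENNReal.tendsto_ofReal (h1.congr' ?_)
    filter_upwards [eventually_gt_atTop 0] with n hn
    have hn0 : (0 : ℝ) < n := by exact_mod_cast hn
    rw [neg_sub, Real.rpow_sub hn0, div_mul_div_comm]
  have hsum := hbad.add hlim
  rw [add_zero] at hsum
  refine tendsto_of_tendsto_of_tendsto_of_le_of_le' tendsto_const_nhds hsum
    (.of_forall fun _ => zero_le) ?_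
  have hlarge : ∀ᶠ n : ℕ in atTop, 4 ≤ c * n :=
    (tendsto_natCast_atTop_atTop.const_mul_atTop hc).eventually_ge_atTop 4
  filter_upwards [eventually_gt_atTop 0, hlarge] with n hn hcn
  have hn0 : (0 : ℝ) < n := by exact_mod_cast hn
  have hpow : 0 < ε * (n : ℝ) ^ (θ γ + δ) := by positivity
  set G : (Fin n → ℕ) → Prop := fun d => c * n ≤ ∑ k, (d k : ℝ) ∧ ∑ k, (d k : ℝ) ^ a ≤ C * n
    with hG
  have hcard : ∀ d, G d → ((Finset.univ.filter fun σ : StubPairing d =>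
      ε * (n : ℝ) ^ (θ γ + δ) ≤ T n d σ.edgeCount).card : ℝ) ≤
      K * (n : ℝ) ^ θ a / (ε * (n : ℝ) ^ (θ γ + δ)) * Fintype.card (StubPairing d) := by
    intro d hd
    have hL : 4 ≤ ∑ k, d k := by exact_mod_cast hcn.trans hd.1
    have hmean := hK n d hn hL hd.1 hd.2
    generalize K * (n : ℝ) ^ θ a = M at hmean ⊢
    generalize ε * (n : ℝ) ^ (θ γ + δ) = η at hpow ⊢
    exact card_filter_le_of_sum_le (T := fun σ : StubPairing d => T n d σ.edgeCount)
      (fun σ => hT0 n d σ.edgeCount) hpow hmean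
  have hcond := (hX n).measure_le (hDm n) G (fun d x => ε * (n : ℝ) ^ (θ γ + δ) ≤ T n d x)
    (by positivity) hcard
  -- Either the sample violates the moment bounds, which is unlikely, or the degrees lie in `G` and
  -- the conditional Markov bound applies.
  have hunion := (measure_union_le {ω |
      ¬ (∑ i ∈ Finset.range n, ((S i ω : ℝ) + 1) ^ a ≤ C * n ∧
        c * n ≤ ∑ i ∈ Finset.range n, (S i ω : ℝ))} _).trans (add_le_add_right hcond _)
  refine le_trans (measure_mono ?_) hunion
  intro ω hω
  by_cases hgood : ∑ i ∈ Finset.range n, ((S i ω : ℝ) + 1) ^ a ≤ C * n ∧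
      c * n ≤ ∑ i ∈ Finset.range n, (S i ω : ℝ)
  · right
    refine ⟨⟨?_, ?_⟩, ?_⟩
    · refine hgood.2.trans ?_
      rw [← Fin.sum_univ_eq_sum_range (fun i => (S i ω : ℝ)), hD]
      gcongr with i
      exact le_evenDegrees (fun i : Fin n => S i ω) i
    · refine le_trans ?_ hgood.1
      rw [← Fin.sum_univ_eq_sum_range (fun i => ((S i ω : ℝ) + 1) ^ a), hD]
      gcongr with i
      exact_mod_cast evenDegrees_le (fun i : Fin n => S i ω) i
    · have hω' : ε ≤ ‖T n (D n ω) (X n ω) / (n : ℝ) ^ (θ γ + δ) - 0‖ := hω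
      rw [sub_zero, Real.norm_of_nonneg (div_nonneg (hT0 _ _ _) (by positivity)),
        le_div_iff₀ (by positivity)] at hω'
      exact hω'
  · left
    exact hgood

end Main

theorem corollary2p2 {Ω : Type*} [MeasurableSpace Ω] (P : Measure Ω) [IsProbabilityMeasure P]
    (γ : ℝ) (hγ1 : 1 < γ) (hγ2 : γ < 2)
    (ν : Measure ℕ) (hν : HasRegularlyVaryingTail ν γ)
    -- the i.i.d. sample `D₁, D₂, …` from `ν`
    (S : ℕ → Ω → ℕ) (hS : iIndepFun S P) (hSν : ∀ i, HasLaw (S i) ν P)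
    -- the degree sequence of the `n`-th graph, with the parity correction
    (D : (n : ℕ) → Ω → Fin n → ℕ) (hD : ∀ n ω, D n ω = evenDegrees fun i : Fin n => S i ω)
    -- the edge multiplicities of the `n`-th configuration model
    (X : (n : ℕ) → Ω → Fin n → Fin n → ℕ) (hX : ∀ n, IsConfigurationModel P (D n) (X n)) :
    (∀ (p : ℕ) (δ : ℝ), 0 < δ →
      TendstoInMeasure P
        (fun (n : ℕ) ω => (∑ i, (D n ω i : ℝ) ^ p * (removedStubs (X n ω) i : ℝ)) /
          (n : ℝ) ^ ((p : ℝ) / γ + 2 - γ + δ))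
        atTop (fun _ => (0 : ℝ))) ∧
    (∀ δ : ℝ, 0 < δ →
      TendstoInMeasure P
        (fun (n : ℕ) ω => (∑ i, ∑ j ∈ Finset.Ioi i,
            (removedEdges (X n ω) i j : ℝ) * (D n ω i : ℝ) * (D n ω j : ℝ)) /
          (n : ℝ) ^ (2 / γ + 2 - γ + δ))
        atTop (fun _ => (0 : ℝ))) ∧
    (∀ (q : ℕ) (δ : ℝ), 1 ≤ q → 0 < δ →
      TendstoInMeasure P
        (fun (n : ℕ) ω => |∑ i, (D n ω i : ℝ) ^ q - ∑ i, (erasedDegree (X n ω) i : ℝ) ^ q| /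
          (n : ℝ) ^ (((q : ℝ) - 1) / γ + 2 - γ + δ))
        atTop (fun _ => (0 : ℝ))) := by
  have hcont : ∀ r : ℝ, ContinuousAt (fun a : ℝ => r / a + 2 - a) γ := fun r =>
    ((continuousAt_const.div continuousAt_id (by simp; linarith)).add continuousAt_const).sub
      continuousAt_id
  refine ⟨fun p δ hδ => ?_, fun δ hδ => ?_, fun q δ hq hδ => ?_⟩
  · refine tendstoInMeasure_div_rpow hγ1 hγ2 hν hS hSν hD hX
      (fun n d x => ∑ i, (d i : ℝ) ^ p * (removedStubs x i : ℝ)) (fun n d x => by positivity)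
      (hcont p) (fun a c C ha1 ha2 hc hC => ⟨_, ?_, fun n d hn hL hlow hup =>
        StubPairing.sum_pow_mul_removedStubs_le_rpow ha1 ha2 hc hC hn hL hlow hup p⟩) hδ
    positivity
  · refine tendstoInMeasure_div_rpow hγ1 hγ2 hν hS hSν hD hX
      (fun n d x => ∑ i, ∑ j ∈ Finset.Ioi i, (removedEdges x i j : ℝ) * (d i : ℝ) * (d j : ℝ))
      (fun n d x => by positivity)
      (hcont 2) (fun a c C ha1 ha2 hc hC => ⟨_, ?_, fun n d hn hL hlow hup =>
        StubPairing.sum_removedEdges_mul_mul_le_rpow ha1 ha2 hc hC hn hL hlow hup⟩) hδ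
    positivity
  · have hq' : ((q - 1 : ℕ) : ℝ) = (q : ℝ) - 1 := by
      rw [Nat.cast_sub hq, Nat.cast_one]
    refine tendstoInMeasure_div_rpow hγ1 hγ2 hν hS hSν hD hX
      (fun n d x => |∑ i, (d i : ℝ) ^ q - ∑ i, (erasedDegree x i : ℝ) ^ q|)
      (fun n d x => abs_nonneg _) (hcont (q - 1)) (fun a c C ha1 ha2 hc hC => ?_) hδ
    refine ⟨q * (6 * c ^ (-a) * (C ^ (((q - 1 : ℕ) + a) / a) * C) +
      2 * c⁻¹ * C ^ (((q - 1 : ℕ) + 2) / a)), by positivity, fun n d hn hL hlow hup => ?_⟩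
    refine (Finset.sum_le_sum fun σ _ =>
      StubPairing.abs_sum_pow_sub_sum_erasedDegree_pow_le σ q).trans ?_
    rw [← Finset.mul_sum, ← hq', mul_assoc, mul_assoc]
    refine mul_le_mul_of_nonneg_left ?_ (Nat.cast_nonneg _)
    rw [← mul_assoc]
    exact StubPairing.sum_pow_mul_removedStubs_le_rpow ha1 ha2 hc hC hn hL hlow hup (q - 1)
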